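/- **Proposition 3.4.** Let $F:\mathbb R^n\times\mathbb R^m\to\mathbb R\cup\{+\infty\}$ be closed proper convex, with subdifferential $\partial F$, and put $L(x,p)=\inf_{u\in\mathbb R^m}\{F(x,u)-\langle u,p\rangle\}$ and $D(s,p)=\inf_{x\in\mathbb R^n,\,u\in\mathbb R^m}\{F(x,u)-\langle u,p\rangle-\langle x,s\rangle\}$. The primal problem is $\min_{x}F(x,0)$ and the dual problem is $\max_{p}D(0,p)$. A saddle point of $L$ is a pair $(x^*,p^*)$ with $L(x^*,p)\le L(x^*,p^*)\le L(x,p^*)$ for all $x,p$. Let $\epsilon\in(0,1)$ and let the sequences $\{x^k\}_{k\ge1},\{w^k\}_{k\ge0},\{s^k\}_{k\ge1}\subset\mathbb R^n$, $\{p^k\}_{k\ge0},\{\bar p^k\}_{k\ge0},\{u^k\}_{k\ge1}\subset\mathbb R^m$ and $\{\rho_k\},\{U_k\},\{S_k\},\{A_k\},\{\Delta_k\},\{\gamma_k\},\{c_k\}\subset\mathbb R$ ($k\ge0$), with $\inf_k c_k>0$, satisfy for all $k\ge0$ $$\begin{aligned} (s^{k+1},0)&\in\partial F(x^{k+1},u^{k+1})+(0,\,c_ku^{k+1}-p^k),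 &&&(1)\\ U_k&=\|u^{k+1}\|^2>0,\qquad S_k=\|s^{k+1}\|^2,\qquad A_k=\tfrac1{c_k}\,|\langle x^{k+1}-w^k,s^{k+1}\rangle|,\\ \Delta_k&=(U_k-A_k)^2-\epsilon U_k(U_k+S_k)\ge0,\qquad \gamma_k\in[-1,1],\\ \rho_k&=\frac{U_k-A_k+\gamma_k\sqrt{\Delta_k}}{U_k+S_k}>0,\\ w^{k+1}&=w^k-\rho_kc_ks^{k+1},\qquad \bar p^k=p^k-c_ku^{k+1},\qquad p^{k+1}=(1-\rho_k)p^k+\rho_k\bar p^k. &&&(2) \end{aligned}$$ Then these sequences satisfy the relaxed relative-error recursions: for all $k\ge0$, (1) and (2) hold together with $$\rho_k\Big(\frac2{c_k}\Big)|\langle x^{k+1}-w^k,s^{k+1}\rangle|+\rho_k^2\|s^{k+1}\|^2\le(2\rho_k-\rho_k^2-\epsilon)\|u^{k+1}\|^2,\qquad 2\rho_k-\rho_k^2-\epsilon\ge0 .$$ Moreover, if $L$ has a saddle point, then: - $\{\bar p^k\}$, $\{p^k\}$ and $\{w^k\}$ are bounded; - $u^k\to0$, $c_ku^{k+1}\to0$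 and $s^k\to0$; - the optimal values of the primal and dual problems are finite and equal, and both $F(x^k,u^k)$ and $D(s^{k+1},\bar p^k)$ converge to this common value; - every accumulation point of $\{x^k\}$ solves the primal problem; - every accumulation point of $\{\bar p^k\}$ or of $\{p^k\}$ solves the dual problem. If $L$ has no saddle point, then at least one of $\{x^k\}$ and $\{\bar p^k\}$ is unbounded. -/

import Mathlib

open Filter Topology
open scoped Pointwise

namespace RelaxedALM

/-- A function `F : ℝⁿ × ℝᵐ → ℝ ∪ {+∞}` (extended-real valued, never `-∞`) that is closed, proper
and convex: not identically `+∞`, with convex epigraph, and lower semicontinuous. -/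
structure IsClosedProperConvex {n m : ℕ}
    (F : EuclideanSpace ℝ (Fin n) → EuclideanSpace ℝ (Fin m) → EReal) : Prop where
  ne_bot : ∀ x u, F x u ≠ ⊥
  exists_ne_top : ∃ x u, F x u ≠ ⊤
  convex_epigraph : Convex ℝ
    {q : (EuclideanSpace ℝ (Fin n) × EuclideanSpace ℝ (Fin m)) × ℝ | F q.1.1 q.1.2 ≤ (q.2 : EReal)}
  lowerSemicontinuous : LowerSemicontinuous
    (fun q : EuclideanSpace ℝ (Fin n) × EuclideanSpace ℝ (Fin m) => F q.1 q.2)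

/-- The subdifferential `∂F(x, u)` as a set of pairs `(s, p)`:
`F(x', u') ≥ F(x, u) + ⟨s, x' - x⟩ + ⟨p, u' - u⟩` for all `(x', u')`. -/
def subdiff {n m : ℕ} (F : EuclideanSpace ℝ (Fin n) → EuclideanSpace ℝ (Fin m) → EReal)
    (x : EuclideanSpace ℝ (Fin n)) (u : EuclideanSpace ℝ (Fin m)) :
    Set (EuclideanSpace ℝ (Fin n) × EuclideanSpace ℝ (Fin m)) :=
  {g | ∀ x' u', F x u + ((inner ℝ g.1 (x' - x) + inner ℝ g.2 (u' - u) : ℝ) : EReal) ≤ F x' u'}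

/-- The Lagrangian `L(x, p) = inf_u { F(x, u) - ⟨u, p⟩ }`. -/
noncomputable def lagrangian {n m : ℕ}
    (F : EuclideanSpace ℝ (Fin n) → EuclideanSpace ℝ (Fin m) → EReal)
    (x : EuclideanSpace ℝ (Fin n)) (p : EuclideanSpace ℝ (Fin m)) : EReal :=
  ⨅ u : EuclideanSpace ℝ (Fin m), (F x u - ((inner ℝ u p : ℝ) : EReal))

/-- The dual function `D(s, p) = inf_{x, u} { F(x, u) - ⟨u, p⟩ - ⟨x, s⟩ }`. -/
noncomputable def dualFun {n m : ℕ}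
    (F : EuclideanSpace ℝ (Fin n) → EuclideanSpace ℝ (Fin m) → EReal)
    (s : EuclideanSpace ℝ (Fin n)) (p : EuclideanSpace ℝ (Fin m)) : EReal :=
  ⨅ (x : EuclideanSpace ℝ (Fin n)) (u : EuclideanSpace ℝ (Fin m)),
    (F x u - ((inner ℝ u p : ℝ) : EReal) - ((inner ℝ x s : ℝ) : EReal))

/-- `(x, p)` is a saddle point of the Lagrangian: `L(x, p') ≤ L(x, p) ≤ L(x', p)` for all
`x'` and `p'`, that is, `L(x, p') ≤ L(x', p)` for all `x'` and `p'`. -/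
def IsSaddlePoint {n m : ℕ} (F : EuclideanSpace ℝ (Fin n) → EuclideanSpace ℝ (Fin m) → EReal)
    (x : EuclideanSpace ℝ (Fin n)) (p : EuclideanSpace ℝ (Fin m)) : Prop :=
  IsSaddlePointOn Set.univ Set.univ (lagrangian F) x p

/-- The relaxed relative-error recursions. The entries `x 0`, `s 0`, `u 0` are not used. -/
structure RelaxedRecursions {n m : ℕ}
    (F : EuclideanSpace ℝ (Fin n) → EuclideanSpace ℝ (Fin m) → EReal) (ε : ℝ)
    (x w s : ℕ → EuclideanSpace ℝ (Fin n)) (p pbar u : ℕ → EuclideanSpace ℝ (Fin m))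
    (ρ c : ℕ → ℝ) : Prop where
  inclusion : ∀ k, (s (k + 1), (0 : EuclideanSpace ℝ (Fin m))) ∈
    subdiff F (x (k + 1)) (u (k + 1)) +
      {((0 : EuclideanSpace ℝ (Fin n)), c k • u (k + 1) - p k)}
  approx : ∀ k, ρ k * (2 / c k) * |inner ℝ (x (k + 1) - w k) (s (k + 1))|
      + ρ k ^ 2 * ‖s (k + 1)‖ ^ 2 ≤ (2 * ρ k - ρ k ^ 2 - ε) * ‖u (k + 1)‖ ^ 2
  relax : ∀ k, 0 ≤ 2 * ρ k - ρ k ^ 2 - ε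
  w_update : ∀ k, w (k + 1) = w k - (ρ k * c k) • s (k + 1)
  pbar_eq : ∀ k, pbar k = p k - c k • u (k + 1)
  p_update : ∀ k, p (k + 1) = (1 - ρ k) • p k + ρ k • pbar k

end RelaxedALM

/-! ### Minimax, Debrunner–Flor extension, and affine minorants -/

namespace RelaxedALM

/-! Inclusion (1) says `(s (k+1), pbar k) ∈ ∂F (x (k+1), u (k+1))`, so the iterates lie on the graph
of the partial inverse `(x, p) ↦ (s, u)` of `∂F`. This operator is monotone, and its zeros are
saddle points. The choice of `ρ k` between the roots of a quadratic is exactly the relative-error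
criterion. That criterion makes `‖p k - ph‖² + ‖w k - xh‖²` drop by at least `ε ‖c k • u (k+1)‖²` at
each step, for every `(xh, ph)` monotonically related to all iterates (`energy_step`). Hence `c u`,
`u` and `s` tend to zero (`asymptotics`).

If a saddle point exists, it serves as `(xh, ph)`; subgradient inequalities then squeeze the
objective values, and semicontinuity handles the accumulation points.

If `x` and `pbar` are bounded, Debrunner–Flor supplies a point `(xh, ph)` related to all iterates,
not itself known to be a saddle point. The same energy argument gives `u, s → 0`, and closedness of
the graph of `∂F` makes any cluster point of `(x, pbar)` a saddle point. This is the contrapositive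
of the last claim. -/

theorem exists_mem_stdSimplex_forall_sum_nonneg {ι : Type*} [Fintype ι] [Nonempty ι]
    (K : ι → ι → ℝ) (hK : ∀ i j, 0 ≤ K i j + K j i) :
    ∃ l ∈ stdSimplex ℝ ι, ∀ i, 0 ≤ ∑ j, l j * K i j := by
  classical
  set Φ : (ι → ℝ) → (ι → ℝ) → ℝ := fun a b => ∑ i, ∑ j, a i * b j * K i j with hΦ
  have hcx : ∀ b, ConvexOn ℝ (stdSimplex ℝ ι) (fun a => Φ a b) := fun b =>
    ⟨convex_stdSimplex ℝ ι, fun a _ a' _ r t _ _ _ => by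
      simp only [hΦ, Pi.add_apply, Pi.smul_apply, smul_eq_mul, Finset.mul_sum,
        ← Finset.sum_add_distrib]
      exact le_of_eq (Finset.sum_congr rfl fun i _ => Finset.sum_congr rfl fun j _ => by ring)⟩
  have hcy : ∀ a, ConcaveOn ℝ (stdSimplex ℝ ι) (fun b => Φ a b) := fun a =>
    ⟨convex_stdSimplex ℝ ι, fun b _ b' _ r t _ _ _ => by
      simp only [hΦ, Pi.add_apply, Pi.smul_apply, smul_eq_mul, Finset.mul_sum,
        ← Finset.sum_add_distrib]
      exact le_of_eq (Finset.sum_congr rfl fun i _ => Finset.sum_congr rfl fun j _ => by ring)⟩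
  have hne : (stdSimplex ℝ ι).Nonempty := ⟨_, single_mem_stdSimplex ℝ (Classical.arbitrary ι)⟩
  obtain ⟨a, ha, b, hb, hab⟩ := Sion.exists_isSaddlePointOn (f := Φ) hne
    (convex_stdSimplex ℝ ι) (isCompact_stdSimplex ℝ ι)
    (fun b _ => (by fun_prop : Continuous fun a => Φ a b).lowerSemicontinuous.lowerSemicontinuousOn _)
    (fun b _ => (hcx b).quasiconvexOn)
    (convex_stdSimplex ℝ ι) hne (isCompact_stdSimplex ℝ ι)
    (fun a _ => (by fun_prop : Continuous fun b => Φ a b).upperSemicontinuous.upperSemicontinuousOn _)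
    (fun a _ => (hcy a).quasiconcaveOn)
  -- Only the symmetric part of `K` contributes on the diagonal. Testing the saddle inequality at a
  -- vertex and at `a` then bounds each row sum below by `Φ a a`.
  have hdiag : 0 ≤ Φ a a := by
    have hsym : Φ a a = ∑ i, ∑ j, a i * a j * K j i := by
      simp only [hΦ]
      rw [Finset.sum_comm]
      exact Finset.sum_congr rfl fun i _ => Finset.sum_congr rfl fun j _ => by ring
    have h2 : 0 ≤ Φ a a + Φ a a := by
      nth_rewrite 2 [hsym]
      simp only [hΦ, ← Finset.sum_add_distrib, ← mul_add]
      exact Finset.sum_nonneg fun i _ => Finset.sum_nonneg fun j _ =>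
        mul_nonneg (mul_nonneg (ha.1 i) (ha.1 j)) (hK i j)
    linarith
  refine ⟨b, hb, fun i => hdiag.trans ((hab _ (single_mem_stdSimplex ℝ i) a ha).trans_eq ?_)⟩
  simp only [hΦ]
  rw [Finset.sum_eq_single i (fun j _ hj => by simp [hj]) (by simp)]
  simp

/-- Debrunner-Flor: a monotone family of functionals based at points of a compact convex set `C`
extends by the zero functional at some point of `C`. -/
theorem exists_mem_forall_apply_sub_nonneg {ι Z : Type*} [AddCommGroup Z] [Module ℝ Z]
    [TopologicalSpace Z] [IsTopologicalAddGroup Z] [T2Space Z] {C : Set Z}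
    (hC : IsCompact C) (hconv : Convex ℝ C) (hne : C.Nonempty) (z : ι → Z) (hz : ∀ i, z i ∈ C)
    (g : ι → Z →L[ℝ] ℝ) (hg : ∀ i j, 0 ≤ g i (z i - z j) + g j (z j - z i)) :
    ∃ y ∈ C, ∀ i, 0 ≤ g i (z i - y) := by
  -- Compactness reduces to finite subfamilies, where the barycentre of the `z j` with the minimax
  -- weights works.
  have key := hC.inter_iInter_nonempty (fun i => {y | 0 ≤ g i (z i - y)})
    (fun i => isClosed_le continuous_const (by fun_prop)) (fun t => by
      rcases t.eq_empty_or_nonempty with rfl | ht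
      · simpa using hne
      have : Nonempty t := ht.to_subtype
      obtain ⟨l, hl, hl'⟩ := exists_mem_stdSimplex_forall_sum_nonneg
        (fun i j : t => g i (z i - z j)) (fun i j => hg i j)
      refine ⟨∑ j, l j • z j, hconv.sum_mem (fun i _ => hl.1 i) hl.2 (fun i _ => hz i), ?_⟩
      simp only [Set.mem_iInter, Set.mem_ofPred_eq]
      intro i hi
      refine (hl' ⟨i, hi⟩).trans_eq ?_
      simp only [map_sub, map_sum, map_smul, smul_eq_mul, mul_sub, Finset.sum_sub_distrib,
        ← Finset.sum_mul, hl.2, one_mul])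
  obtain ⟨y, hy, hy'⟩ := key
  exact ⟨y, hy, by simpa using hy'⟩

/-- A proper closed convex function is the supremum of its affine minorants. -/
theorem exists_affine_le_of_lt {E : Type*} [NormedAddCommGroup E] [InnerProductSpace ℝ E]
    [CompleteSpace E] {g : E → EReal} (hconv : Convex ℝ {q : E × ℝ | g q.1 ≤ (q.2 : EReal)})
    (hlsc : LowerSemicontinuous g) {b : E} {t₀ : ℝ} (hb : g b = t₀) {a : E} {r : ℝ}
    (hr : (r : EReal) < g a) : ∃ q : E, ∀ y, ((r + inner ℝ q (y - a) : ℝ) : EReal) ≤ g y := by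
  have hclosed : IsClosed {q : E × ℝ | g q.1 ≤ (q.2 : EReal)} :=
    (lowerSemicontinuous_iff_isClosed_epigraph.1 hlsc).preimage
      (f := fun q : E × ℝ => (q.1, (q.2 : EReal)))
      (continuous_fst.prodMk (continuous_coe_real_ereal.comp continuous_snd))
  -- separation of a point below the graph from the epigraph, with nonnegative vertical slope
  have sep : ∀ (a' : E) (r' : ℝ), (r' : EReal) < g a' → ∃ (f : E →L[ℝ] ℝ) (β α : ℝ), 0 ≤ β ∧
      f a' + β * r' < α ∧ ∀ y (t : ℝ), g y ≤ t → α < f y + β * t := by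
    intro a' r' h'
    obtain ⟨f, α, h1, h2⟩ := geometric_hahn_banach_point_closed (x := (a', r')) hconv hclosed
      (by simpa using h')
    have hf : ∀ y (t : ℝ), f (y, t) = f.comp (.inl ℝ E ℝ) y + f (0, 1) * t := by
      intro y t
      have : (y, t) = (y, (0 : ℝ)) + t • ((0 : E), (1 : ℝ)) := by simp
      rw [this, map_add, map_smul]
      simp [mul_comm]
    refine ⟨f.comp (.inl ℝ E ℝ), f (0, 1), α, ?_, by rwa [← hf], fun y t hy => ?_⟩
    -- With negative slope the separating functional would tend to `-∞` along the vertical ray above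
    -- `b`.
    · by_contra! hneg
      have h3 : ∀ t : ℝ, t₀ ≤ t → α < f.comp (.inl ℝ E ℝ) b + f (0, 1) * t := by
        intro t ht
        rw [← hf]
        exact h2 _ (by simpa [hb] using ht)
      set M := f.comp (.inl ℝ E ℝ) b
      have h4 := h3 (max t₀ ((α - M) / f (0, 1))) (le_max_left _ _)
      have h5 : f (0, 1) * max t₀ ((α - M) / f (0, 1)) ≤ f (0, 1) * ((α - M) / f (0, 1)) :=
        mul_le_mul_of_nonpos_left (le_max_right _ _) hneg.le
      rw [mul_div_cancel₀ _ hneg.ne] at h5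
      linarith
    · rw [← hf]
      exact h2 _ hy
  -- If `g a = ⊤`, the hyperplane at `a` may be vertical. Separating below the finite value at `b`
  -- gives a positive slope; `N` copies of the functional at `a` are added, with `N` large enough
  -- that the sum still passes above `(a, r)`.
  obtain ⟨f₁, β₁, α₁, -, h1, h1'⟩ := sep b (t₀ - 1) (by
    rw [hb]; exact_mod_cast sub_one_lt t₀)
  have hβ₁ : 0 < β₁ := by
    have := h1' b t₀ hb.le
    nlinarith
  obtain ⟨f, β, α, hβ, h2, h2'⟩ := sep a r hr
  obtain ⟨N, hN⟩ : ∃ N : ℝ, 0 ≤ N ∧ 0 ≤ α₁ - f₁ a - β₁ * r + N * (α - (f a + β * r)) := by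
    refine ⟨|α₁ - f₁ a - β₁ * r| / (α - (f a + β * r)), by
      have := sub_pos.2 h2; positivity, ?_⟩
    rw [div_mul_cancel₀ _ (sub_pos.2 h2).ne']
    linarith [neg_abs_le (α₁ - f₁ a - β₁ * r)]
  have hpos : 0 < β₁ + N * β := by have := mul_nonneg hN.1 hβ; linarith
  refine ⟨(InnerProductSpace.toDual ℝ E).symm (-(β₁ + N * β)⁻¹ • (f₁ + N • f)), fun y => ?_⟩
  have hreal : ∀ t : ℝ, g y ≤ t →
      r + inner ℝ ((InnerProductSpace.toDual ℝ E).symm (-(β₁ + N * β)⁻¹ • (f₁ + N • f))) (y - a)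
        ≤ t := by
    intro t ht
    rw [InnerProductSpace.toDual_symm_apply]
    have e1 := h1' y t ht
    have e2 := mul_le_mul_of_nonneg_left (h2' y t ht).le hN.1
    have e3 : (β₁ + N * β) * (r - t) ≤ (f₁ + N • f) (y - a) := by
      simp only [add_apply, smul_apply, smul_eq_mul,
        map_sub]
      nlinarith [hN.2]
    have e4 : (-(β₁ + N * β)⁻¹ • (f₁ + N • f)) (y - a)
        = -((β₁ + N * β)⁻¹ * (f₁ + N • f) (y - a)) := by
      simp
      ring
    rw [e4]
    have e5 := mul_le_mul_of_nonneg_left e3 (inv_pos.2 hpos).le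
    rw [inv_mul_cancel_left₀ hpos.ne'] at e5
    linarith
  exact EReal.le_of_forall_lt_iff_le.1 fun t ht => by
    exact_mod_cast hreal t ht.le

end RelaxedALM

/-! ### Lagrangian duality and saddle values -/

namespace RelaxedALM

variable {n m : ℕ} {F : EuclideanSpace ℝ (Fin n) → EuclideanSpace ℝ (Fin m) → EReal}

theorem coe_le_sub_coe_iff {a b : ℝ} {y : EReal} :
    (a : EReal) ≤ y - (b : EReal) ↔ ((a + b : ℝ) : EReal) ≤ y := by
  rw [EReal.le_sub_iff_add_le (Or.inl (EReal.coe_ne_bot b)) (Or.inl (EReal.coe_ne_top b)),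
    EReal.coe_add]

theorem coe_le_lagrangian_iff {r : ℝ} {x : EuclideanSpace ℝ (Fin n)}
    {q : EuclideanSpace ℝ (Fin m)} :
    (r : EReal) ≤ lagrangian F x q ↔ ∀ u, ((r + inner ℝ q u : ℝ) : EReal) ≤ F x u := by
  simp only [lagrangian, le_iInf_iff, coe_le_sub_coe_iff, real_inner_comm q]

theorem coe_le_dualFun_iff {r : ℝ} {s : EuclideanSpace ℝ (Fin n)}
    {q : EuclideanSpace ℝ (Fin m)} :
    (r : EReal) ≤ dualFun F s q ↔
      ∀ x u, ((r + inner ℝ s x + inner ℝ q u : ℝ) : EReal) ≤ F x u := by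
  simp only [dualFun, le_iInf_iff, coe_le_sub_coe_iff, real_inner_comm q, real_inner_comm s]

theorem mem_subdiff_iff {x : EuclideanSpace ℝ (Fin n)} {u : EuclideanSpace ℝ (Fin m)} {r : ℝ}
    (hr : F x u = r) {s : EuclideanSpace ℝ (Fin n)} {q : EuclideanSpace ℝ (Fin m)} :
    (s, q) ∈ subdiff F x u ↔ ∀ x' u',
      ((r + inner ℝ s (x' - x) + inner ℝ q (u' - u) : ℝ) : EReal) ≤ F x' u' := by
  simp only [subdiff, Set.mem_ofPred_eq, hr, ← EReal.coe_add, add_assoc]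

theorem IsClosedProperConvex.exists_coe (hF : IsClosedProperConvex F) :
    ∃ x u, ∃ r : ℝ, F x u = r := by
  obtain ⟨x, u, h⟩ := hF.exists_ne_top
  exact ⟨x, u, _, (EReal.coe_toReal h (hF.ne_bot x u)).symm⟩

theorem IsClosedProperConvex.eq_coe_of_mem_subdiff (hF : IsClosedProperConvex F)
    {x : EuclideanSpace ℝ (Fin n)} {u : EuclideanSpace ℝ (Fin m)}
    {g : EuclideanSpace ℝ (Fin n) × EuclideanSpace ℝ (Fin m)} (hg : g ∈ subdiff F x u) :
    ∃ r : ℝ, F x u = r := by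
  refine ⟨_, (EReal.coe_toReal (fun htop => ?_) (hF.ne_bot x u)).symm⟩
  obtain ⟨x₀, u₀, r, hr⟩ := hF.exists_coe
  have := hg x₀ u₀
  rw [htop, EReal.top_add_coe, hr, top_le_iff] at this
  exact EReal.coe_ne_top _ this

theorem dualFun_eq_of_mem_subdiff {x : EuclideanSpace ℝ (Fin n)} {u : EuclideanSpace ℝ (Fin m)}
    {r : ℝ} (hr : F x u = r) {s : EuclideanSpace ℝ (Fin n)} {q : EuclideanSpace ℝ (Fin m)}
    (h : (s, q) ∈ subdiff F x u) :
    dualFun F s q = ((r - inner ℝ s x - inner ℝ q u : ℝ) : EReal) := by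
  refine le_antisymm ?_ (coe_le_dualFun_iff.2 fun x' u' => ?_)
  · refine (iInf₂_le x u).trans_eq ?_
    rw [hr, real_inner_comm q, real_inner_comm s, ← EReal.coe_sub, ← EReal.coe_sub]
    congr 1
    ring
  · convert (mem_subdiff_iff hr).1 h x' u' using 2
    simp only [inner_sub_right]
    ring

theorem isSaddlePoint_of_forall_le
    {xs : EuclideanSpace ℝ (Fin n)} {ps : EuclideanSpace ℝ (Fin m)} {v : ℝ} (hv : F xs 0 = v)
    (h : ∀ x u, ((v + inner ℝ ps u : ℝ) : EReal) ≤ F x u) : IsSaddlePoint F xs ps := by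
  intro x _ q _
  calc lagrangian F xs q ≤ F xs 0 - ((inner ℝ (0 : EuclideanSpace ℝ (Fin m)) q : ℝ) : EReal) :=
        iInf_le _ _
    _ = v := by simp [hv]
    _ ≤ lagrangian F x ps := coe_le_lagrangian_iff.2 (h x)

theorem IsClosedProperConvex.exists_affine_le_of_lt (hF : IsClosedProperConvex F)
    {x : EuclideanSpace ℝ (Fin n)} {u₀ u₁ : EuclideanSpace ℝ (Fin m)} (hx : F x u₀ ≠ ⊤) {r : ℝ}
    (hr : (r : EReal) < F x u₁) :
    ∃ q, ∀ u, ((r + inner ℝ q (u - u₁) : ℝ) : EReal) ≤ F x u := by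
  refine RelaxedALM.exists_affine_le_of_lt (g := F x) ?_ ?_
    (EReal.coe_toReal hx (hF.ne_bot x u₀)).symm hr
  · intro y hy z hz a b ha hb hab
    have := hF.convex_epigraph (x := ((x, y.1), y.2)) hy (y := ((x, z.1), z.2)) hz ha hb hab
    simpa [← add_smul, hab] using this
  · exact hF.lowerSemicontinuous.comp (by fun_prop : Continuous fun u => (x, u))

/-- At a saddle point of the Lagrangian there is no duality gap, and both values are attained. -/
theorem IsClosedProperConvex.exists_value_of_isSaddlePoint (hF : IsClosedProperConvex F)
    {xs : EuclideanSpace ℝ (Fin n)} {ps : EuclideanSpace ℝ (Fin m)} (h : IsSaddlePoint F xs ps) :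
    ∃ v : ℝ, F xs 0 = v ∧ ∀ x u, ((v + inner ℝ ps u : ℝ) : EReal) ≤ F x u := by
  obtain ⟨x₀, u₀, r₀, hr₀⟩ := hF.exists_coe
  obtain ⟨u₁, hu₁⟩ : ∃ u, F xs u ≠ ⊤ := by
    by_contra! hall
    have h1 := h x₀ trivial ps trivial
    have h2 : lagrangian F xs ps = ⊤ := by simp [lagrangian, hall]
    have h3 : lagrangian F x₀ ps ≤ ((r₀ - inner ℝ u₀ ps : ℝ) : EReal) := by
      rw [EReal.coe_sub, ← hr₀]
      exact iInf_le _ u₀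
    rw [h2] at h1
    exact EReal.coe_ne_top _ (top_le_iff.1 (h1.trans h3))
  -- An affine minorant of `F xs` with slope `q` and value `r` at `0` gives `r ≤ L(xs, q)`, and the
  -- saddle inequality passes this on to `L(x, ps)`.
  have key : ∀ r : ℝ, (r : EReal) < F xs 0 →
      ∀ x u, ((r + inner ℝ ps u : ℝ) : EReal) ≤ F x u := by
    intro r hr x
    obtain ⟨q, hq⟩ := hF.exists_affine_le_of_lt hu₁ hr
    exact coe_le_lagrangian_iff.1
      ((coe_le_lagrangian_iff.2 (by simpa using hq)).trans (h x trivial q trivial))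
  have hle : ∀ x u, F xs 0 + ((inner ℝ ps u : ℝ) : EReal) ≤ F x u := by
    intro x u
    refine EReal.add_le_of_le_sub (EReal.ge_of_forall_gt_iff_ge.1 fun r hr => ?_)
    exact coe_le_sub_coe_iff.2 (key r hr x u)
  have hne : F xs 0 ≠ ⊤ := by
    intro htop
    have := hle x₀ u₀
    rw [htop, EReal.top_add_coe, hr₀, top_le_iff] at this
    exact EReal.coe_ne_top _ this
  have hv := EReal.coe_toReal hne (hF.ne_bot xs 0)
  refine ⟨_, hv.symm, fun x u => ?_⟩
  rw [EReal.coe_add, hv]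
  exact hle x u

/-! ### One-step estimates -/

namespace RelaxedRecursions

variable {ε : ℝ} {x w s : ℕ → EuclideanSpace ℝ (Fin n)} {p pbar u : ℕ → EuclideanSpace ℝ (Fin m)}
  {ρ c : ℕ → ℝ}

theorem mem_subdiff (h : RelaxedRecursions F ε x w s p pbar u ρ c) (k : ℕ) :
    (s (k + 1), pbar k) ∈ subdiff F (x (k + 1)) (u (k + 1)) := by
  obtain ⟨g, hg, a, ha, hga⟩ := Set.mem_add.1 (h.inclusion k)
  rw [Set.mem_singleton_iff.1 ha, Prod.ext_iff] at hga
  have h1 : g.1 = s (k + 1) := by simpa using hga.1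
  have h2 : g.2 = pbar k := by
    rw [h.pbar_eq, ← neg_sub, ← eq_neg_of_add_eq_zero_left (by simpa using hga.2)]
  rwa [← h1, ← h2]

/-- Both updates are steps of length `ρ c`, along `u` and `s`. After the squares are expanded, the
cross terms are controlled by `hmono` times `ρ c` and by the error criterion times `c²`. Nothing
else is asked of `(xh, ph)`. -/
theorem energy_step (h : RelaxedRecursions F ε x w s p pbar u ρ c) {k : ℕ} (hρ : 0 < ρ k)
    (hc : 0 < c k) {xh : EuclideanSpace ℝ (Fin n)} {ph : EuclideanSpace ℝ (Fin m)}
    (hmono : 0 ≤ inner ℝ (s (k + 1)) (x (k + 1) - xh) + inner ℝ (u (k + 1)) (pbar k - ph)) :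
    ‖p (k + 1) - ph‖ ^ 2 + ‖w (k + 1) - xh‖ ^ 2 + ε * ‖c k • u (k + 1)‖ ^ 2
      ≤ ‖p k - ph‖ ^ 2 + ‖w k - xh‖ ^ 2 := by
  have hp : p (k + 1) - ph = (p k - ph) - (ρ k * c k) • u (k + 1) := by
    rw [h.p_update, h.pbar_eq]
    module
  have hw : w (k + 1) - xh = (w k - xh) - (ρ k * c k) • s (k + 1) := by
    rw [h.w_update]
    module
  have e1 : inner ℝ (u (k + 1)) (pbar k - ph)
      = inner ℝ (p k - ph) (u (k + 1)) - c k * ‖u (k + 1)‖ ^ 2 := by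
    rw [h.pbar_eq, sub_right_comm, inner_sub_right, real_inner_comm, inner_smul_right,
      real_inner_self_eq_norm_sq]
  have e2 : inner ℝ (s (k + 1)) (x (k + 1) - xh)
      = inner ℝ (x (k + 1) - w k) (s (k + 1)) + inner ℝ (w k - xh) (s (k + 1)) := by
    rw [← inner_add_left, sub_add_sub_cancel, real_inner_comm]
  rw [e1, e2] at hmono
  have happ := h.approx k
  have habs := le_abs_self (inner ℝ (x (k + 1) - w k) (s (k + 1)))
  rw [hp, hw, norm_sub_sq_real (p k - ph), norm_sub_sq_real (w k - xh), inner_smul_right,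
    inner_smul_right, norm_smul, norm_smul, norm_smul, mul_pow, mul_pow, mul_pow,
    Real.norm_eq_abs, Real.norm_eq_abs, sq_abs, sq_abs]
  generalize inner ℝ (x (k + 1) - w k) (s (k + 1)) = a at *
  generalize inner ℝ (p k - ph) (u (k + 1)) = b at *
  generalize inner ℝ (w k - xh) (s (k + 1)) = d at *
  have h1 : ρ k * (2 / c k) * a ≤ ρ k * (2 / c k) * |a| :=
    mul_le_mul_of_nonneg_left habs (by positivity)
  have h2 := mul_le_mul_of_nonneg_left ((add_le_add_left h1 _).trans happ) (sq_nonneg (c k))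
  have h3 : c k ^ 2 * (ρ k * (2 / c k) * a + ρ k ^ 2 * ‖s (k + 1)‖ ^ 2)
      = 2 * (ρ k * c k) * a + c k ^ 2 * ρ k ^ 2 * ‖s (k + 1)‖ ^ 2 := by
    field_simp
  rw [h3] at h2
  have h4 := mul_nonneg (mul_pos hρ hc).le hmono
  nlinarith

/-- The relaxation bound forces `ρ ≥ ε / 2`, while `2ρ - ρ² - ε ≤ 1` turns the error criterion into
`ρ ‖s‖ ≤ ‖u‖`. -/
theorem norm_s_le (h : RelaxedRecursions F ε x w s p pbar u ρ c) (hε : 0 < ε) {k : ℕ}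
    (hρ : 0 < ρ k) (hc : 0 < c k) : ‖s (k + 1)‖ ≤ 2 / ε * ‖u (k + 1)‖ := by
  have h1 := h.approx k
  have h2 := h.relax k
  have h3 : 0 ≤ ρ k * (2 / c k) * |inner ℝ (x (k + 1) - w k) (s (k + 1))| := by positivity
  have h4 : ε / 2 ≤ ρ k := by nlinarith [sq_nonneg (ρ k)]
  have h5 : 2 * ρ k - ρ k ^ 2 - ε ≤ 1 := by nlinarith [sq_nonneg (ρ k - 1)]
  have h6 : (ρ k * ‖s (k + 1)‖) ^ 2 ≤ ‖u (k + 1)‖ ^ 2 := by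
    nlinarith [sq_nonneg ‖u (k + 1)‖, mul_le_mul_of_nonneg_right h5 (sq_nonneg ‖u (k + 1)‖)]
  have h7 := (sq_le_sq₀ (by positivity) (norm_nonneg _)).1 h6
  rw [div_mul_eq_mul_div, le_div_iff₀ hε]
  nlinarith [norm_nonneg (s (k + 1))]

theorem abs_inner_le (h : RelaxedRecursions F ε x w s p pbar u ρ c) (hε : 0 < ε) {k : ℕ}
    (hρ : 0 < ρ k) (hc : 0 < c k) :
    |inner ℝ (x (k + 1) - w k) (s (k + 1))| ≤ ‖c k • u (k + 1)‖ * ‖u (k + 1)‖ / ε := by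
  have h1 := h.approx k
  have h2 := h.relax k
  have h4 : ε / 2 ≤ ρ k := by nlinarith [sq_nonneg (ρ k)]
  have h5 : 2 * ρ k - ρ k ^ 2 - ε ≤ 1 := by nlinarith [sq_nonneg (ρ k - 1)]
  rw [norm_smul, Real.norm_of_nonneg hc.le, le_div_iff₀ hε]
  have h3 := abs_nonneg (inner ℝ (x (k + 1) - w k) (s (k + 1)))
  generalize |inner ℝ (x (k + 1) - w k) (s (k + 1))| = a at *
  have h6 : ρ k * (2 / c k) * a ≤ ‖u (k + 1)‖ ^ 2 := by
    nlinarith [mul_le_mul_of_nonneg_right h5 (sq_nonneg ‖u (k + 1)‖),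
      mul_nonneg (sq_nonneg (ρ k)) (sq_nonneg ‖s (k + 1)‖)]
  have h7 := mul_le_mul_of_nonneg_left h6 hc.le
  have h8 : c k * (ρ k * (2 / c k) * a) = 2 * ρ k * a := by field_simp
  rw [h8] at h7
  nlinarith

end RelaxedRecursions

end RelaxedALM

/-! ### Closedness and monotonicity of the subdifferential -/

namespace RelaxedALM

variable {n m : ℕ} {F : EuclideanSpace ℝ (Fin n) → EuclideanSpace ℝ (Fin m) → EReal}

/-- The graph of the subdifferential is closed. -/
theorem IsClosedProperConvex.mem_subdiff_of_tendsto (hF : IsClosedProperConvex F)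
    {xk sk : ℕ → EuclideanSpace ℝ (Fin n)} {uk pk : ℕ → EuclideanSpace ℝ (Fin m)}
    {x s : EuclideanSpace ℝ (Fin n)} {u p : EuclideanSpace ℝ (Fin m)}
    (hx : Tendsto xk atTop (𝓝 x)) (hu : Tendsto uk atTop (𝓝 u)) (hs : Tendsto sk atTop (𝓝 s))
    (hp : Tendsto pk atTop (𝓝 p)) (h : ∀ k, (sk k, pk k) ∈ subdiff F (xk k) (uk k)) :
    (s, p) ∈ subdiff F x u := by
  intro x' u'
  -- Finiteness of `F x u` is not yet known, so the limit is taken with reals `r` below it.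
  refine EReal.add_le_of_le_sub (EReal.ge_of_forall_gt_iff_ge.1 fun r hr => ?_)
  refine coe_le_sub_coe_iff.2 ?_
  have hlim : Tendsto (fun k => r + (inner ℝ (sk k) (x' - xk k) + inner ℝ (pk k) (u' - uk k)))
      atTop (𝓝 (r + (inner ℝ s (x' - x) + inner ℝ p (u' - u)))) :=
    ((hs.inner (hx.const_sub x')).add (hp.inner (hu.const_sub u'))).const_add r
  refine le_of_tendsto (EReal.tendsto_coe.2 hlim) ?_
  filter_upwards [(hx.prodMk_nhds hu).eventually (hF.lowerSemicontinuous (x, u) r hr)] with k hk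
  rw [EReal.coe_add]
  exact (add_le_add_left hk.le _).trans (h k x' u')

theorem IsClosedProperConvex.isSaddlePoint_of_mem_subdiff (hF : IsClosedProperConvex F)
    {xs : EuclideanSpace ℝ (Fin n)} {ps : EuclideanSpace ℝ (Fin m)}
    (h : (0, ps) ∈ subdiff F xs 0) : IsSaddlePoint F xs ps := by
  obtain ⟨v, hv⟩ := hF.eq_coe_of_mem_subdiff h
  exact isSaddlePoint_of_forall_le hv fun x u => by
    simpa using (mem_subdiff_iff hv).1 h x u

/-- Monotonicity of the partial inverse of the subdifferential. -/
theorem IsClosedProperConvex.inner_add_inner_nonneg (hF : IsClosedProperConvex F)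
    {x x' s s' : EuclideanSpace ℝ (Fin n)} {u u' q q' : EuclideanSpace ℝ (Fin m)}
    (h : (s, q) ∈ subdiff F x u) (h' : (s', q') ∈ subdiff F x' u') :
    0 ≤ inner ℝ (s - s') (x - x') + inner ℝ (u - u') (q - q') := by
  obtain ⟨r, hr⟩ := hF.eq_coe_of_mem_subdiff h
  obtain ⟨r', hr'⟩ := hF.eq_coe_of_mem_subdiff h'
  have h1 := (mem_subdiff_iff hr).1 h x' u'
  have h2 := (mem_subdiff_iff hr').1 h' x u
  rw [hr', EReal.coe_le_coe_iff] at h1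
  rw [hr, EReal.coe_le_coe_iff] at h2
  rw [real_inner_comm]
  simp only [inner_sub_left, inner_sub_right, real_inner_comm u, real_inner_comm u',
    real_inner_comm x, real_inner_comm x'] at *
  linarith

/-! ### Asymptotic behaviour of the iterates -/

namespace RelaxedRecursions

variable {ε : ℝ} {x w s : ℕ → EuclideanSpace ℝ (Fin n)} {p pbar u : ℕ → EuclideanSpace ℝ (Fin m)}
  {ρ c : ℕ → ℝ}

theorem asymptotics (h : RelaxedRecursions F ε x w s p pbar u ρ c) (hε : 0 < ε)
    (hρ : ∀ k, 0 < ρ k) {c₀ : ℝ} (hc₀ : 0 < c₀) (hc : ∀ k, c₀ ≤ c k)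
    {xh : EuclideanSpace ℝ (Fin n)} {ph : EuclideanSpace ℝ (Fin m)}
    (hmono : ∀ k,
      0 ≤ inner ℝ (s (k + 1)) (x (k + 1) - xh) + inner ℝ (u (k + 1)) (pbar k - ph)) :
    Bornology.IsBounded (Set.range p) ∧ Bornology.IsBounded (Set.range w) ∧
      Tendsto (fun k => c k • u (k + 1)) atTop (𝓝 0) ∧
      Tendsto (fun k => u (k + 1)) atTop (𝓝 0) ∧ Tendsto (fun k => s (k + 1)) atTop (𝓝 0) ∧
      Tendsto (fun k => inner ℝ (x (k + 1) - w k) (s (k + 1))) atTop (𝓝 0) := by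
  have hcpos : ∀ k, 0 < c k := fun k => hc₀.trans_le (hc k)
  set V : ℕ → ℝ := fun k => ‖p k - ph‖ ^ 2 + ‖w k - xh‖ ^ 2 with hV
  have hstep : ∀ k, V (k + 1) + ε * ‖c k • u (k + 1)‖ ^ 2 ≤ V k := fun k =>
    h.energy_step (hρ k) (hcpos k) (hmono k)
  have hanti : Antitone V := antitone_nat_of_succ_le fun k =>
    (le_add_of_nonneg_right (by positivity)).trans (hstep k)
  have hbdd : BddBelow (Set.range V) := ⟨0, by rintro _ ⟨k, rfl⟩; positivity⟩
  have hlim := tendsto_atTop_ciInf hanti hbdd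
  -- The energy is decreasing and bounded below, so its successive differences vanish; they dominate
  -- `ε ‖c k • u (k+1)‖²`.
  have hdiff : Tendsto (fun k => (V k - V (k + 1)) / ε) atTop (𝓝 0) := by
    simpa using (hlim.sub (hlim.comp (tendsto_add_atTop_nat 1))).div_const ε
  have hcu : Tendsto (fun k => c k • u (k + 1)) atTop (𝓝 0) := by
    rw [tendsto_zero_iff_norm_tendsto_zero]
    have hsq : Tendsto (fun k => ‖c k • u (k + 1)‖ ^ 2) atTop (𝓝 0) :=
      squeeze_zero (fun k => by positivity) (fun k => by
        rw [le_div_iff₀ hε]; linarith [hstep k]) hdiff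
    simpa using hsq.sqrt
  have hu : Tendsto (fun k => u (k + 1)) atTop (𝓝 0) := by
    refine squeeze_zero_norm (fun k => ?_) (by simpa using hcu.norm.div_const c₀)
    rw [le_div_iff₀ hc₀, norm_smul, Real.norm_of_nonneg (hcpos k).le, mul_comm]
    exact mul_le_mul_of_nonneg_right (hc k) (norm_nonneg _)
  refine ⟨?_, ?_, hcu, hu, ?_, ?_⟩
  · refine (Metric.isBounded_closedBall (x := ph) (r := √(V 0))).subset ?_
    rintro _ ⟨k, rfl⟩
    rw [mem_closedBall_iff_norm]
    refine Real.le_sqrt_of_sq_le (le_trans ?_ (hanti (Nat.zero_le k)))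
    exact le_add_of_nonneg_right (by positivity)
  · refine (Metric.isBounded_closedBall (x := xh) (r := √(V 0))).subset ?_
    rintro _ ⟨k, rfl⟩
    rw [mem_closedBall_iff_norm]
    refine Real.le_sqrt_of_sq_le (le_trans ?_ (hanti (Nat.zero_le k)))
    exact le_add_of_nonneg_left (by positivity)
  · exact squeeze_zero_norm (fun k => h.norm_s_le hε (hρ k) (hcpos k))
      (by simpa using hu.norm.const_mul (2 / ε))
  · exact squeeze_zero_norm (fun k => h.abs_inner_le hε (hρ k) (hcpos k))
      (by simpa using (hcu.norm.mul hu.norm).div_const ε)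

/-- If the iterates stay bounded then the Lagrangian has a saddle point. -/
theorem exists_isSaddlePoint (h : RelaxedRecursions F ε x w s p pbar u ρ c)
    (hF : IsClosedProperConvex F) (hε : 0 < ε)
    (hρ : ∀ k, 0 < ρ k) {c₀ : ℝ} (hc₀ : 0 < c₀) (hc : ∀ k, c₀ ≤ c k)
    (hx : Bornology.IsBounded (Set.range x)) (hp : Bornology.IsBounded (Set.range pbar)) :
    ∃ xs ps, IsSaddlePoint F xs ps := by
  obtain ⟨R, hR⟩ := (hx.prod hp).subset_closedBall 0
  have hmem : ∀ k, (x (k + 1), pbar k) ∈ Metric.closedBall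
      (0 : EuclideanSpace ℝ (Fin n) × EuclideanSpace ℝ (Fin m)) R := fun k =>
    hR ⟨Set.mem_range_self _, Set.mem_range_self _⟩
  obtain ⟨y, -, hy⟩ := exists_mem_forall_apply_sub_nonneg
    (isCompact_closedBall _ R) (convex_closedBall _ _) ⟨_, hmem 0⟩ _ hmem
    (fun k => (innerSL ℝ (s (k + 1))).coprod (innerSL ℝ (u (k + 1)))) (fun i j => by
      have := hF.inner_add_inner_nonneg (h.mem_subdiff i) (h.mem_subdiff j)
      simp only [ContinuousLinearMap.coprod_apply, innerSL_apply_apply, Prod.mk_sub_mk,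
        inner_sub_left, inner_sub_right] at this ⊢
      linarith)
  -- The point `y` only drives the energy estimate; the saddle point comes from a convergent
  -- subsequence.
  obtain ⟨-, -, -, hu, hs, -⟩ := h.asymptotics hε hρ hc₀ hc (xh := y.1) (ph := y.2)
    (fun k => by simpa using hy k)
  obtain ⟨⟨xs, ps⟩, -, φ, hφ, hlim⟩ := tendsto_subseq_of_bounded Metric.isBounded_closedBall hmem
  exact ⟨xs, ps, hF.isSaddlePoint_of_mem_subdiff (hF.mem_subdiff_of_tendsto
    (hlim.fst_nhds) (hu.comp hφ.tendsto_atTop) (hs.comp hφ.tendsto_atTop) hlim.snd_nhds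
    fun k => h.mem_subdiff (φ k))⟩

/-- The objective values and the values of `⟪x, s⟫` converge. -/
theorem tendsto_values (h : RelaxedRecursions F ε x w s p pbar u ρ c)
    {xs : EuclideanSpace ℝ (Fin n)} {ps : EuclideanSpace ℝ (Fin m)} {v : ℝ} (hv : F xs 0 = v)
    (hps : ∀ x u, ((v + inner ℝ ps u : ℝ) : EReal) ≤ F x u)
    {f : ℕ → ℝ} (hf : ∀ k, F (x (k + 1)) (u (k + 1)) = f k)
    (hw : Bornology.IsBounded (Set.range w)) (hp : Bornology.IsBounded (Set.range pbar))
    (hu : Tendsto (fun k => u (k + 1)) atTop (𝓝 0))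
    (hs : Tendsto (fun k => s (k + 1)) atTop (𝓝 0))
    (hxw : Tendsto (fun k => inner ℝ (x (k + 1) - w k) (s (k + 1))) atTop (𝓝 0)) :
    Tendsto (fun k => inner ℝ (s (k + 1)) (x (k + 1))) atTop (𝓝 0) ∧
      Tendsto (fun k => inner ℝ (pbar k) (u (k + 1))) atTop (𝓝 0) ∧
      Tendsto f atTop (𝓝 v) := by
  have hbd : ∀ {d : ℕ} {a b : ℕ → EuclideanSpace ℝ (Fin d)},
      Bornology.IsBounded (Set.range a) → Tendsto b atTop (𝓝 0) →
      Tendsto (fun k => inner ℝ (a k) (b k)) atTop (𝓝 0) := by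
    intro d a b ha hb
    obtain ⟨R, hR⟩ := isBounded_iff_forall_norm_le.1 ha
    refine squeeze_zero_norm (fun k => (norm_inner_le_norm _ _).trans ?_)
      (by simpa using hb.norm.const_mul R)
    exact mul_le_mul_of_nonneg_right (hR _ (Set.mem_range_self k)) (norm_nonneg _)
  -- No bound on `x` is available: write `x = (x - w) + w`, with the first part handled by the error
  -- criterion and `w` bounded.
  have hsx : Tendsto (fun k => inner ℝ (s (k + 1)) (x (k + 1))) atTop (𝓝 0) := by
    have := hxw.add (hbd hw hs)
    simp only [← inner_add_left, sub_add_cancel, add_zero] at this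
    exact this.congr fun k => real_inner_comm _ _
  have hpu := hbd hp hu
  -- The lower bound comes from optimality of `ps`, the upper one from the subgradient inequality at
  -- the iterate tested at `(xs, 0)`.
  refine ⟨hsx, hpu, tendsto_of_tendsto_of_tendsto_of_le_of_le
    (g := fun k => v + inner ℝ ps (u (k + 1)))
    (h := fun k => v + inner ℝ (s (k + 1)) (x (k + 1)) + inner ℝ (pbar k) (u (k + 1))
      - inner ℝ (s (k + 1)) xs) ?_ ?_ (fun k => ?_) (fun k => ?_)⟩
  · simpa using (tendsto_const_nhds (x := ps)).inner hu |>.const_add v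
  · simpa using ((hsx.const_add v).add hpu).sub (hs.inner (tendsto_const_nhds (x := xs)))
  · have := hps (x (k + 1)) (u (k + 1))
    rwa [hf, EReal.coe_le_coe_iff] at this
  · have := (mem_subdiff_iff (hf k)).1 (h.mem_subdiff k) xs 0
    rw [hv, EReal.coe_le_coe_iff] at this
    simp only [inner_sub_right, inner_zero_right] at this
    linarith

/-- Limits of subsequences of the multipliers are dual optimal. -/
theorem le_dualFun_of_tendsto (h : RelaxedRecursions F ε x w s p pbar u ρ c) {v : ℝ}
    {f : ℕ → ℝ} (hf : ∀ k, F (x (k + 1)) (u (k + 1)) = f k)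
    (hs : Tendsto (fun k => s (k + 1)) atTop (𝓝 0))
    (hsx : Tendsto (fun k => inner ℝ (s (k + 1)) (x (k + 1))) atTop (𝓝 0))
    (hpu : Tendsto (fun k => inner ℝ (pbar k) (u (k + 1))) atTop (𝓝 0))
    (hfv : Tendsto f atTop (𝓝 v)) {φ : ℕ → ℕ} (hφ : Tendsto φ atTop atTop)
    {q : EuclideanSpace ℝ (Fin m)} (hq : Tendsto (pbar ∘ φ) atTop (𝓝 q)) :
    (v : EReal) ≤ dualFun F 0 q := by
  refine coe_le_dualFun_iff.2 fun x' u' => ?_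
  have hlim : Tendsto (fun k => f (φ k) + inner ℝ (s (φ k + 1)) (x' - x (φ k + 1))
      + inner ℝ (pbar (φ k)) (u' - u (φ k + 1))) atTop
      (𝓝 (v + inner ℝ (0 : EuclideanSpace ℝ (Fin n)) x' + inner ℝ q u')) := by
    have h1 := ((hs.comp hφ).inner (tendsto_const_nhds (x := x'))).sub (hsx.comp hφ)
    have h2 := (hq.inner (tendsto_const_nhds (x := u'))).sub (hpu.comp hφ)
    rw [sub_zero] at h1 h2
    simp only [inner_sub_right]
    exact ((hfv.comp hφ).add h1).add h2
  exact le_of_tendsto' (EReal.tendsto_coe.2 hlim) fun k =>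
    (mem_subdiff_iff (hf _)).1 (h.mem_subdiff _) x' u'

end RelaxedRecursions

end RelaxedALM

/-! ### The root formula for the relaxation factor, and the conclusions -/

namespace RelaxedALM

variable {n m : ℕ} {F : EuclideanSpace ℝ (Fin n) → EuclideanSpace ℝ (Fin m) → EReal}
  {ε : ℝ} {x w s : ℕ → EuclideanSpace ℝ (Fin n)} {p pbar u : ℕ → EuclideanSpace ℝ (Fin m)}
  {ρ c : ℕ → ℝ}

/-- A relaxation factor between the roots of `(U + S) ρ² - 2 (U - A) ρ + ε U` makes this quadratic
nonpositive. -/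
theorem two_mul_mul_add_le_of_root {ε U S A Δ γ ρ : ℝ} (hUS : 0 < U + S)
    (hΔ : Δ = (U - A) ^ 2 - ε * U * (U + S)) (hΔnn : 0 ≤ Δ) (hγ : γ ∈ Set.Icc (-1 : ℝ) 1)
    (hρ : ρ = (U - A + γ * √Δ) / (U + S)) :
    2 * ρ * A + ρ ^ 2 * S ≤ (2 * ρ - ρ ^ 2 - ε) * U := by
  have h1 : (U + S) * ρ - (U - A) = γ * √Δ := by
    rw [hρ, mul_div_cancel₀ _ hUS.ne']
    ring
  have h2 : ((U + S) * ρ - (U - A)) ^ 2 ≤ Δ := by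
    rw [h1, mul_pow, Real.sq_sqrt hΔnn]
    exact mul_le_of_le_one_left hΔnn ((sq_le_one_iff_abs_le_one γ).2 (abs_le.2 hγ))
  have h3 : (U + S) * (2 * ρ * A + ρ ^ 2 * S - (2 * ρ - ρ ^ 2 - ε) * U) ≤ 0 := by
    rw [hΔ] at h2
    linarith
  linarith [nonpos_of_mul_nonpos_right h3 hUS]

theorem relaxedRecursions_of_root {U S A Δ γ : ℕ → ℝ} (hc : ∀ k, 0 < c k)
    (hincl : ∀ k, (s (k + 1), (0 : EuclideanSpace ℝ (Fin m))) ∈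
      subdiff F (x (k + 1)) (u (k + 1)) +
        {((0 : EuclideanSpace ℝ (Fin n)), c k • u (k + 1) - p k)})
    (hU : ∀ k, U k = ‖u (k + 1)‖ ^ 2) (hUpos : ∀ k, 0 < U k)
    (hS : ∀ k, S k = ‖s (k + 1)‖ ^ 2)
    (hA : ∀ k, A k = 1 / c k * |inner ℝ (x (k + 1) - w k) (s (k + 1))|)
    (hΔ : ∀ k, Δ k = (U k - A k) ^ 2 - ε * U k * (U k + S k)) (hΔnn : ∀ k, 0 ≤ Δ k)
    (hγ : ∀ k, γ k ∈ Set.Icc (-1 : ℝ) 1)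
    (hρ : ∀ k, ρ k = (U k - A k + γ k * √(Δ k)) / (U k + S k)) (hρpos : ∀ k, 0 < ρ k)
    (hw : ∀ k, w (k + 1) = w k - (ρ k * c k) • s (k + 1))
    (hpbar : ∀ k, pbar k = p k - c k • u (k + 1))
    (hp : ∀ k, p (k + 1) = (1 - ρ k) • p k + ρ k • pbar k) :
    RelaxedRecursions F ε x w s p pbar u ρ c := by
  have hSnn : ∀ k, 0 ≤ S k := fun k => by rw [hS]; positivity
  have hAnn : ∀ k, 0 ≤ A k := fun k => by
    have := hc k
    rw [hA]
    positivity
  have hroot := fun k => two_mul_mul_add_le_of_root (add_pos_of_pos_of_nonneg (hUpos k) (hSnn k))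
    (hΔ k) (hΔnn k) (hγ k) (hρ k)
  refine ⟨hincl, fun k => ?_, fun k => ?_, hw, hpbar, hp⟩
  · rw [← hU, ← hS]
    convert hroot k using 2
    rw [hA]
    ring
  -- The left side of the root inequality is nonnegative and `U k > 0`.
  · refine nonneg_of_mul_nonneg_left (le_trans ?_ (hroot k)) (hUpos k)
    have := hρpos k
    have := hAnn k
    have := hSnn k
    positivity

theorem RelaxedRecursions.conclusions_of_isSaddlePoint
    (h : RelaxedRecursions F ε x w s p pbar u ρ c) (hF : IsClosedProperConvex F) (hε : 0 < ε)
    (hρ : ∀ k, 0 < ρ k) {c₀ : ℝ} (hc₀ : 0 < c₀) (hc : ∀ k, c₀ ≤ c k)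
    {xs : EuclideanSpace ℝ (Fin n)} {ps : EuclideanSpace ℝ (Fin m)} (hsad : IsSaddlePoint F xs ps) :
    (Bornology.IsBounded (Set.range pbar) ∧ Bornology.IsBounded (Set.range p) ∧
        Bornology.IsBounded (Set.range w)) ∧
      (Tendsto u atTop (𝓝 0) ∧ Tendsto (fun k => c k • u (k + 1)) atTop (𝓝 0) ∧
        Tendsto s atTop (𝓝 0)) ∧
      (∃ v : ℝ, (⨅ y, F y 0) = (v : EReal) ∧ (⨆ q, dualFun F 0 q) = (v : EReal) ∧
        Tendsto (fun k => F (x k) (u k)) atTop (𝓝 (v : EReal)) ∧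
        Tendsto (fun k => dualFun F (s (k + 1)) (pbar k)) atTop (𝓝 (v : EReal))) ∧
      (∀ y, MapClusterPt y atTop x → ∀ y', F y 0 ≤ F y' 0) ∧
      (∀ q, MapClusterPt q atTop pbar → ∀ q', dualFun F 0 q' ≤ dualFun F 0 q) ∧
      (∀ q, MapClusterPt q atTop p → ∀ q', dualFun F 0 q' ≤ dualFun F 0 q) := by
  obtain ⟨v, hv, hps⟩ := hF.exists_value_of_isSaddlePoint hsad
  have hsub : (0, ps) ∈ subdiff F xs 0 := (mem_subdiff_iff hv).2 (by simpa using hps)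
  obtain ⟨hpb, hwb, hcu, hu, hs, hxw⟩ := h.asymptotics hε hρ hc₀ hc (xh := xs) (ph := ps)
    (fun k => by simpa using hF.inner_add_inner_nonneg (h.mem_subdiff k) hsub)
  have hpbarb : Bornology.IsBounded (Set.range pbar) := by
    refine (hpb.sub (Metric.isBounded_range_of_tendsto _ hcu)).subset ?_
    rintro _ ⟨k, rfl⟩
    rw [h.pbar_eq]
    exact Set.sub_mem_sub (Set.mem_range_self k) (Set.mem_range_self k)
  choose f hf using fun k => hF.eq_coe_of_mem_subdiff (h.mem_subdiff k)
  obtain ⟨hsx, hpu, hfv⟩ := h.tendsto_values hv hps hf hwb hpbarb hu hs hxw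
  have hF_lim : Tendsto (fun k => F (x k) (u k)) atTop (𝓝 (v : EReal)) := by
    rw [← tendsto_add_atTop_iff_nat 1]
    simpa only [hf] using EReal.tendsto_coe.2 hfv
  have hu' : Tendsto u atTop (𝓝 0) := (tendsto_add_atTop_iff_nat 1).1 hu
  have hprimal : ∀ y, (v : EReal) ≤ F y 0 := fun y => by simpa using hps y 0
  have hweak : ∀ q, dualFun F 0 q ≤ v := fun q =>
    (iInf₂_le xs 0).trans_eq (by simp [hv])
  have hdual : ∀ φ : ℕ → ℕ, Tendsto φ atTop atTop → ∀ q, Tendsto (pbar ∘ φ) atTop (𝓝 q) →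
      ∀ q', dualFun F 0 q' ≤ dualFun F 0 q := fun φ hφ q hq q' =>
    (hweak q').trans (h.le_dualFun_of_tendsto hf hs hsx hpu hfv hφ hq)
  refine ⟨⟨hpbarb, hpb, hwb⟩, ⟨hu', hcu, (tendsto_add_atTop_iff_nat 1).1 hs⟩,
    ⟨v, ?_, ?_, hF_lim, ?_⟩, fun y hy y' => ?_, fun q hq => ?_, fun q hq => ?_⟩
  · exact le_antisymm ((iInf_le _ xs).trans_eq hv) (le_iInf hprimal)
  · exact le_antisymm (iSup_le hweak)
      ((coe_le_dualFun_iff.2 (by simpa using hps)).trans (le_iSup (dualFun F 0) ps))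
  · simp only [fun k => dualFun_eq_of_mem_subdiff (hf k) (h.mem_subdiff k)]
    exact EReal.tendsto_coe.2 (by simpa using (hfv.sub hsx).sub hpu)
  · obtain ⟨φ, hφ, hlim⟩ := hy.tendsto_subseq
    refine (EReal.ge_of_forall_gt_iff_ge.1 fun r hr => ?_).trans (hprimal y')
    refine ge_of_tendsto (hF_lim.comp hφ.tendsto_atTop) ?_
    filter_upwards [(hlim.prodMk_nhds (hu'.comp hφ.tendsto_atTop)).eventually
      (hF.lowerSemicontinuous (y, 0) r hr)] with k hk
    exact hk.le
  · obtain ⟨φ, hφ, hlim⟩ := hq.tendsto_subseq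
    exact hdual φ hφ.tendsto_atTop q hlim
  · obtain ⟨φ, hφ, hlim⟩ := hq.tendsto_subseq
    refine hdual φ hφ.tendsto_atTop q ?_
    -- Since `c u → 0`, `pbar` has the same limit as `p` along the subsequence.
    have := hlim.sub (hcu.comp hφ.tendsto_atTop)
    rw [sub_zero] at this
    exact this.congr fun k => (h.pbar_eq (φ k)).symm

end RelaxedALM

theorem proposition3p4 {n m : ℕ}
    (F : EuclideanSpace ℝ (Fin n) → EuclideanSpace ℝ (Fin m) → EReal)
    (hF : RelaxedALM.IsClosedProperConvex F)
    (ε : ℝ) (hε : ε ∈ Set.Ioo (0 : ℝ) 1)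
    (x w s : ℕ → EuclideanSpace ℝ (Fin n)) (p pbar u : ℕ → EuclideanSpace ℝ (Fin m))
    (ρ c U S A Δ γ : ℕ → ℝ)
    (hc : 0 < ⨅ k, c k)
    (hincl : ∀ k, (s (k + 1), (0 : EuclideanSpace ℝ (Fin m))) ∈
      RelaxedALM.subdiff F (x (k + 1)) (u (k + 1)) +
        {((0 : EuclideanSpace ℝ (Fin n)), c k • u (k + 1) - p k)})
    (hU : ∀ k, U k = ‖u (k + 1)‖ ^ 2) (hUpos : ∀ k, 0 < U k)
    (hS : ∀ k, S k = ‖s (k + 1)‖ ^ 2)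
    (hA : ∀ k, A k = 1 / c k * |inner ℝ (x (k + 1) - w k) (s (k + 1))|)
    (hΔ : ∀ k, Δ k = (U k - A k) ^ 2 - ε * U k * (U k + S k)) (hΔnn : ∀ k, 0 ≤ Δ k)
    (hγ : ∀ k, γ k ∈ Set.Icc (-1 : ℝ) 1)
    (hρ : ∀ k, ρ k = (U k - A k + γ k * √(Δ k)) / (U k + S k)) (hρpos : ∀ k, 0 < ρ k)
    (hw : ∀ k, w (k + 1) = w k - (ρ k * c k) • s (k + 1))
    (hpbar : ∀ k, pbar k = p k - c k • u (k + 1))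
    (hp : ∀ k, p (k + 1) = (1 - ρ k) • p k + ρ k • pbar k) :
    -- the relaxed relative-error recursions hold
    RelaxedALM.RelaxedRecursions F ε x w s p pbar u ρ c ∧
    -- convergence if there is a saddle point
    ((∃ xs ps, RelaxedALM.IsSaddlePoint F xs ps) →
      (Bornology.IsBounded (Set.range pbar) ∧ Bornology.IsBounded (Set.range p) ∧
        Bornology.IsBounded (Set.range w)) ∧
      (Tendsto u atTop (𝓝 0) ∧ Tendsto (fun k => c k • u (k + 1)) atTop (𝓝 0) ∧
        Tendsto s atTop (𝓝 0)) ∧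
      -- the primal and dual optimal values are finite and equal, and are the limits
      (∃ v : ℝ, (⨅ y, F y 0) = (v : EReal) ∧ (⨆ q, RelaxedALM.dualFun F 0 q) = (v : EReal) ∧
        Tendsto (fun k => F (x k) (u k)) atTop (𝓝 (v : EReal)) ∧
        Tendsto (fun k => RelaxedALM.dualFun F (s (k + 1)) (pbar k)) atTop (𝓝 (v : EReal))) ∧
      -- accumulation points are optimal
      (∀ y, MapClusterPt y atTop x → ∀ y', F y 0 ≤ F y' 0) ∧
      (∀ q, MapClusterPt q atTop pbar →
        ∀ q', RelaxedALM.dualFun F 0 q' ≤ RelaxedALM.dualFun F 0 q) ∧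
      (∀ q, MapClusterPt q atTop p →
        ∀ q', RelaxedALM.dualFun F 0 q' ≤ RelaxedALM.dualFun F 0 q)) ∧
    -- unboundedness if there is no saddle point
    ((¬ ∃ xs ps, RelaxedALM.IsSaddlePoint F xs ps) →
      ¬ Bornology.IsBounded (Set.range x) ∨ ¬ Bornology.IsBounded (Set.range pbar)) := by
  -- A real infimum over a family unbounded below defaults to `0`, so its positivity forces
  -- boundedness.
  have hbdd : BddBelow (Set.range c) := by
    by_contra hb
    rw [Real.iInf_of_not_bddBelow hb] at hc
    exact hc.false
  have hck : ∀ k, (⨅ k, c k) ≤ c k := fun k => ciInf_le hbdd k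
  have hrec : RelaxedALM.RelaxedRecursions F ε x w s p pbar u ρ c :=
    RelaxedALM.relaxedRecursions_of_root (fun k => hc.trans_le (hck k)) hincl hU hUpos hS hA
      hΔ hΔnn hγ hρ hρpos hw hpbar hp
  refine ⟨hrec, ?_, fun hns => ?_⟩
  · rintro ⟨xs, ps, hsad⟩
    exact hrec.conclusions_of_isSaddlePoint hF hε.1 hρpos hc hck hsad
  · by_contra! hb
    exact hns (hrec.exists_isSaddlePoint hF hε.1 hρpos hc hck hb.1 hb.2)
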